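/- For a convex polytope $P$ of dimension $d$, count among its faces also the improper faces $\emptyset$ (of dimension $-1$) and $P$ itself (of dimension $d$). For a positive integer $m$, the $m$-modular $f$-vector of $P$ is $f^m(P)=(f^m_{-1}(P),f^m_0(P),\ldots,f^m_{m-2}(P))$, where $f^m_i(P)$ is the number of faces of $P$ whose dimension is congruent to $i$ modulo $m$; in particular $f^1(P)$ is the total number of faces of $P$. A cyclic polytope $C(v,d)$ is the convex hull of any $v$ distinct points on the moment curve $\{(t,t^2,\ldots,t^d):t\in\mathbb{R}\}$ in $\mathbb{R}^d$. Theorem 3. Let $n$ be a nonnegative integer, and let $(C_k)_{k=2}^{\infty}$ be a sequence of cyclic polytopes $C_k=C(k+1+n,k)$ (for each $k$ the points on the moment curve may be chosen arbitrarily). Then for every positive integer $m$, $$\lim_{k\to\infty}\frac{f^m(C_k)}{f^1(C_k)}=\Big(\frac1m,\ldots,\frac1m\Big).$$ -/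

import Mathlib

open Filter Topology

/-- The moment curve `t ↦ (t, t², …, t^d)` in `ℝ^d`. -/
noncomputable def momentCurve (d : ℕ) (t : ℝ) : EuclideanSpace ℝ (Fin d) :=
  WithLp.toLp 2 (fun i : Fin d => t ^ ((i : ℕ) + 1))

/-- `P` is a cyclic polytope `C(v, d)`: the convex hull of `v` distinct points on the moment curve
in `ℝ^d`. -/
def IsCyclicPolytope (v d : ℕ) (P : Set (EuclideanSpace ℝ (Fin d))) : Prop :=
  ∃ T : Finset ℝ, T.card = v ∧ P = convexHull ℝ (momentCurve d '' (T : Set ℝ))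

section Faces

variable {E : Type*} [AddCommGroup E] [Module ℝ E] [TopologicalSpace E]

/-- The set of all faces of a polytope `P`: the empty face, `P` itself, and the intersections of
`P` with supporting hyperplanes, i.e. the sets of maximizers on `P` of a linear functional
(the zero functional gives `P`, and `IsExposed` admits the empty set). -/
def polytopeFaces (P : Set E) : Set (Set E) :=
  {F | IsExposed ℝ P F}

open Classical in
/-- The dimension of a face: the dimension of its affine hull, and `-1` for the empty face. -/
noncomputable def faceDim (F : Set E) : ℤ :=
  if F = ∅ then -1 else (Module.finrank ℝ (affineSpan ℝ F).direction : ℤ)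

/-- The `m`-modular `f`-vector of `P`. Its components, traditionally labelled
`i = -1, 0, …, m - 2`, are indexed here by `j = i + 1 = 0, …, m - 1`; the component with label `i`
is the number of faces (the improper faces `∅` and `P` included) whose dimension is congruent to
`i` modulo `m`. -/
noncomputable def modularFVector (m : ℕ) (P : Set E) (j : Fin m) : ℕ :=
  {F ∈ polytopeFaces P | faceDim F ≡ (j : ℤ) - 1 [ZMOD (m : ℤ)]}.ncard

end Faces

/-!
Faces of a polytope `P = conv {M t | t ∈ T}` on the moment curve `M` in `ℝ^d` are determined by
the subset of `T` they contain, so `P` has at most `2 ^ #T` faces. If `#T = d + 1 + n` with `n`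
fixed and `d` large, almost every subset `W` of `T` comes from a face. Indeed, by
`IsZeroSetOfNonneg.exists_face` it suffices to find a polynomial of degree at most `d` which is
nonnegative on `T` and vanishes there exactly on `W`. Group the points of `T` in consecutive pairs
`a < b`. A pair contributes the factor `(X - a) * (X - b)`, `(X - a) ^ 2`, `(X - b) ^ 2` or `1`
according to its intersection with `W`, so the degree is at most `#T` minus twice the number of
pairs missed by `W`, and it suffices that `W` misses more than `n` pairs. The subsets that miss at
most `n` pairs are counted by a Chernoff bound (`exists_count_missed_pairs`): there are at most
`2 ^ (n + 1) * (15 / 8) ^ #T` of them, which is negligible compared with `2 ^ #T`.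

The face belonging to such a `W` is a simplex of dimension `#W - 1`, since at most `d + 1` points
of the moment curve are affinely independent. Hence the `m`-modular `f`-vector of `P` agrees, up to
a negligible error, with the numbers of subsets of `T` of each size modulo `m`
(`abs_modularFVector_sub_le`). These are asymptotically equal, by the roots of unity filter
(`tendsto_card_powerset_filter_modEq`).
-/

/-! ### Equidistribution of subset sizes modulo `m` -/

/-- Orthogonality of the powers of a primitive `m`-th root of unity, as a filter for `a ≡ b`. -/
lemma IsPrimitiveRoot.sum_range_pow_mul_inv_pow {m : ℕ} {ζ : ℂ} (hζ : IsPrimitiveRoot ζ m)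
    (hm : 0 < m) (a b : ℕ) :
    ∑ k ∈ Finset.range m, (ζ ^ k) ^ a * ((ζ ^ k) ^ b)⁻¹ = if a ≡ b [MOD m] then (m : ℂ) else 0 := by
  have hζ0 : ζ ≠ 0 := hζ.ne_zero hm.ne'
  have key : ∀ k, (ζ ^ k) ^ a * ((ζ ^ k) ^ b)⁻¹ = (ζ ^ a * (ζ ^ b)⁻¹) ^ k := by
    intro k
    rw [mul_pow, inv_pow, ← pow_mul, ← pow_mul, ← pow_mul, ← pow_mul, mul_comm k a, mul_comm k b]
  simp_rw [key]
  have hx : ζ ^ a * (ζ ^ b)⁻¹ = 1 ↔ a ≡ b [MOD m] := by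
    rw [mul_inv_eq_one₀ (pow_ne_zero _ hζ0), show ζ ^ a = ζ ^ b ↔ Units.mk0 ζ hζ0 ^ a = Units.mk0 ζ hζ0 ^ b by
      simp [Units.ext_iff], pow_eq_pow_iff_modEq, ← orderOf_units, Units.val_mk0, ← hζ.eq_orderOf]
  split_ifs with h
  · simp [hx.2 h]
  · have h1 : ζ ^ a * (ζ ^ b)⁻¹ ≠ 1 := fun h' => h (hx.1 h')
    rw [geom_sum_eq h1, mul_pow, inv_pow, ← pow_mul, ← pow_mul, mul_comm a, mul_comm b, pow_mul,
      pow_mul, hζ.pow_eq_one]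
    simp

lemma Complex.norm_one_add_lt_two {z : ℂ} (hz : ‖z‖ = 1) (h1 : z ≠ 1) : ‖1 + z‖ < 2 := by
  have h := norm_add_lt_of_not_sameRay (x := (1 : ℂ)) (y := z) (by
    rw [sameRay_iff_of_norm_eq (by simp [hz])]
    exact fun h => h1 h.symm)
  rw [norm_one, hz] at h
  linarith

/-- The sizes of the subsets of a large finite set are equidistributed modulo `m`. -/
lemma tendsto_card_powerset_filter_modEq {α : Type*} (T : ℕ → Finset α)
    (hT : Tendsto (fun k => (T k).card) atTop atTop) {m : ℕ} (hm : 0 < m) (j : ℕ) :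
    Tendsto (fun k => (((T k).powerset.filter fun W => W.card ≡ j [MOD m]).card : ℝ)
      / 2 ^ (T k).card) atTop (𝓝 (1 / (m : ℝ))) := by
  obtain ⟨ζ, hζ⟩ : ∃ ζ : ℂ, IsPrimitiveRoot ζ m := ⟨_, Complex.isPrimitiveRoot_exp m hm.ne'⟩
  have hmC : (m : ℂ) ≠ 0 := Nat.cast_ne_zero.2 hm.ne'
  have formula : ∀ S : Finset α,
      (((S.powerset.filter fun W => W.card ≡ j [MOD m]).card : ℝ) / 2 ^ S.card : ℝ) =
        (1 / (m : ℂ) * ∑ i ∈ Finset.range m,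
          ((1 + ζ ^ i) / 2) ^ S.card * ((ζ ^ i) ^ j)⁻¹).re := by
    intro S
    have h1 : ∀ i, (1 + ζ ^ i) ^ S.card = ∑ W ∈ S.powerset, (ζ ^ i) ^ W.card := by
      intro i
      rw [add_comm, ← Finset.sum_pow_mul_eq_add_pow]
      simp
    have h2 : ∑ i ∈ Finset.range m, ((1 + ζ ^ i) / 2) ^ S.card * ((ζ ^ i) ^ j)⁻¹ =
        (∑ i ∈ Finset.range m, ∑ W ∈ S.powerset, (ζ ^ i) ^ W.card * ((ζ ^ i) ^ j)⁻¹)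
          / 2 ^ S.card := by
      rw [Finset.sum_div]
      refine Finset.sum_congr rfl fun i _ => ?_
      rw [div_pow, h1, ← Finset.sum_mul]
      ring
    rw [h2, Finset.sum_comm]
    simp_rw [hζ.sum_range_pow_mul_inv_pow hm]
    rw [← Finset.sum_filter, Finset.sum_const, nsmul_eq_mul]
    rw [show (1 / (m : ℂ) * ((((S.powerset.filter fun W => W.card ≡ j [MOD m]).card : ℂ) * m)
        / 2 ^ S.card)) =
        ((((S.powerset.filter fun W => W.card ≡ j [MOD m]).card : ℝ) / 2 ^ S.card : ℝ) : ℂ) by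
      push_cast; field_simp]
    rw [Complex.ofReal_re]
  have lim : Tendsto (fun k => 1 / (m : ℂ) * ∑ i ∈ Finset.range m,
      ((1 + ζ ^ i) / 2) ^ (T k).card * ((ζ ^ i) ^ j)⁻¹) atTop
      (𝓝 (1 / (m : ℂ) * ∑ i ∈ Finset.range m, if i = 0 then 1 else 0)) := by
    refine Tendsto.const_mul _ (tendsto_finsetSum _ fun i hi => ?_)
    split_ifs with h0
    · subst h0
      norm_num
    · have hlt : ‖(1 + ζ ^ i) / 2‖ < 1 := by
        rw [norm_div, Complex.norm_two, div_lt_one two_pos]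
        refine Complex.norm_one_add_lt_two ?_ ?_
        · rw [norm_pow, hζ.norm'_eq_one hm.ne', one_pow]
        · exact hζ.pow_ne_one_of_pos_of_lt h0 (Finset.mem_range.1 hi)
      simpa using ((tendsto_pow_atTop_nhds_zero_of_norm_lt_one hlt).comp hT).mul_const
        ((ζ ^ i) ^ j)⁻¹
  have hre : (1 / (m : ℂ) * ∑ i ∈ Finset.range m, if i = 0 then 1 else 0).re = 1 / (m : ℝ) := by
    rw [Finset.sum_ite_eq' (Finset.range m) 0 fun _ => (1 : ℂ), if_pos (Finset.mem_range.2 hm),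
      mul_one, show (1 / (m : ℂ)) = ((1 / (m : ℝ) : ℝ) : ℂ) by push_cast; rfl, Complex.ofReal_re]
  simp_rw [formula]
  rw [← hre]
  exact (Complex.continuous_re.tendsto _).comp lim

/-! ### Nonnegative polynomials of small degree with a prescribed zero set -/

open Polynomial in
/-- `IsZeroSetOfNonneg T W e`: some polynomial of degree at most `e` is nonnegative on `T` and
vanishes there exactly on `W`. Positivity at the points to the right of `T` is part of the
definition because it makes the notion stable under adjoining new largest points to `T`; it also
forces the polynomial to be nonzero. -/
def IsZeroSetOfNonneg (T W : Finset ℝ) (e : ℕ) : Prop :=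
  ∃ p : ℝ[X], p.natDegree ≤ e ∧ (∀ t ∈ T, 0 ≤ p.eval t ∧ (p.eval t = 0 ↔ t ∈ W)) ∧
    ∀ x, (∀ t ∈ T, t < x) → 0 < p.eval x

open Polynomial in
lemma IsZeroSetOfNonneg.mul {T T' W W' : Finset ℝ} {e e' : ℕ} (h : IsZeroSetOfNonneg T W e)
    (q : ℝ[X]) (hq : q.natDegree ≤ e')
    (hsub : T ⊆ T') (hnew : ∀ x ∈ T', x ∉ T → ∀ t ∈ T, t < x)
    (hqT : ∀ t ∈ T, 0 < q.eval t ∧ (t ∈ W' ↔ t ∈ W))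
    (hqN : ∀ t ∈ T', t ∉ T → 0 ≤ q.eval t ∧ (q.eval t = 0 ↔ t ∈ W'))
    (hqR : ∀ x, (∀ t ∈ T', t < x) → 0 < q.eval x) :
    IsZeroSetOfNonneg T' W' (e + e') := by
  obtain ⟨p, hp, hpT, hpR⟩ := h
  refine ⟨p * q, natDegree_mul_le.trans (add_le_add hp hq), fun t ht => ?_, fun x hx => ?_⟩
  · rw [eval_mul]
    by_cases htT : t ∈ T
    · obtain ⟨h1, h2⟩ := hqT t htT
      obtain ⟨h3, h4⟩ := hpT t htT
      exact ⟨mul_nonneg h3 h1.le, by rw [mul_eq_zero, or_iff_left h1.ne', h4, h2]⟩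
    · obtain ⟨h1, h2⟩ := hqN t ht htT
      have h3 := hpR t (hnew t ht htT)
      exact ⟨mul_nonneg h3.le h1, by rw [mul_eq_zero, or_iff_right h3.ne', h2]⟩
  · rw [eval_mul]
    exact mul_pos (hpR x fun t ht => hx t (hsub ht)) (hqR x hx)

open Polynomial in
lemma IsZeroSetOfNonneg.card_le {T W : Finset ℝ} {e : ℕ} (h : IsZeroSetOfNonneg T W e)
    (hW : W ⊆ T) : W.card ≤ e := by
  obtain ⟨p, hp, hpT, hpR⟩ := h
  have hp0 : p ≠ 0 := by
    rintro rfl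
    obtain ⟨M, hM⟩ := T.bddAbove
    simpa using hpR (M + 1) fun t ht => (hM ht).trans_lt (lt_add_one M)
  refine (card_le_degree_of_subset_roots (p := p) fun t ht => ?_).trans hp
  rw [mem_roots hp0, IsRoot]
  exact ((hpT t (hW ht)).2).2 ht

open Polynomial in
/-- Group the points of `T` in consecutive pairs, and let `c W` count the pairs missed by `W`. The
other pairs contribute a quadratic factor each, whence the degree `#T - 2 * c W`. For a single pair
one of the four subsets misses it, so `∑ W, (1/2) ^ c W` gains a factor `7/2 ≤ (15/8) ^ 2`. -/
lemma exists_count_missed_pairs (T : Finset ℝ) :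
    ∃ c : Finset ℝ → ℕ,
      (∀ W ⊆ T, 2 * c W ≤ T.card ∧ IsZeroSetOfNonneg T W (T.card - 2 * c W)) ∧
      ∑ W ∈ T.powerset, (1 / 2 : ℝ) ^ c W ≤ 2 * (15 / 8) ^ T.card := by
  induction hv : T.card using Nat.twoStepInduction generalizing T with
  | zero =>
    rw [Finset.card_eq_zero] at hv
    subst hv
    refine ⟨fun _ => 0, fun W _ => ⟨by simp, 1, by simp, by simp, by simp⟩, by norm_num⟩
  | one =>
    obtain ⟨a, rfl⟩ := Finset.card_eq_one.1 hv
    refine ⟨fun _ => 0, fun W hW => ⟨by simp, ?_⟩, ?_⟩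
    · rcases Finset.subset_singleton_iff.1 hW with rfl | rfl
      · exact ⟨1, by simp, by simp, by simp⟩
      · exact ⟨X - C a, by simp, by simp, by simp⟩
    · simp; norm_num
  | more v ih _ =>
    have hne : T.Nonempty := Finset.card_pos.1 (by omega)
    obtain ⟨b, hbT, hbmax⟩ : ∃ b ∈ T, ∀ t ∈ T, t ≤ b := ⟨T.max' hne, T.max'_mem hne, T.le_max'⟩
    have hc1 : (T.erase b).card = v + 1 := by rw [Finset.card_erase_of_mem hbT]; omega
    have hne1 : (T.erase b).Nonempty := Finset.card_pos.1 (by omega)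
    obtain ⟨a, haT, hamax⟩ : ∃ a ∈ T.erase b, ∀ t ∈ T.erase b, t ≤ a :=
      ⟨_, (T.erase b).max'_mem hne1, (T.erase b).le_max'⟩
    obtain ⟨S, hS⟩ : ∃ S, S = (T.erase b).erase a := ⟨_, rfl⟩
    have hcS : S.card = v := by rw [hS, Finset.card_erase_of_mem haT]; omega
    have hab : a < b := lt_of_le_of_ne (hbmax a (Finset.mem_of_mem_erase haT))
      (Finset.ne_of_mem_erase haT)
    have hSa : ∀ t ∈ S, t < a := fun t ht => by
      rw [hS] at ht
      exact lt_of_le_of_ne (hamax t (Finset.mem_of_mem_erase ht)) (Finset.ne_of_mem_erase ht)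
    have haS : a ∉ S := fun h => (hSa a h).false
    have hbS : b ∉ S := fun h => (hab.trans (hSa b h)).false
    have hbaS : b ∉ insert a S := by simp [hab.ne', hbS]
    have hTS : T = insert b (insert a S) := by
      rw [hS, Finset.insert_erase haT, Finset.insert_erase hbT]
    obtain ⟨c, hc, hsum⟩ := ih S hcS
    refine ⟨fun W => c (W ∩ S) + if a ∈ W ∨ b ∈ W then 0 else 1, fun W hW => ?_, ?_⟩
    · obtain ⟨h2, hWS⟩ := hc (W ∩ S) Finset.inter_subset_right
      have hsub : S ⊆ T := by rw [hTS]; intro t ht; simp [ht]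
      have hmemT : ∀ t ∈ T, t ∉ S → t = a ∨ t = b := fun t ht htS => by
        rw [hTS] at ht; simp only [Finset.mem_insert] at ht; tauto
      have haT' : a ∈ T := Finset.mem_of_mem_erase haT
      have hnew : ∀ x ∈ T, x ∉ S → ∀ t ∈ S, t < x := fun x hx hxS t ht => by
        rcases hmemT x hx hxS with rfl | rfl
        · exact hSa t ht
        · exact (hSa t ht).trans hab
      have hWmem : ∀ t ∈ S, (t ∈ W ↔ t ∈ W ∩ S) := fun t ht => by simp [ht]
      by_cases haW : a ∈ W <;> by_cases hbW : b ∈ W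
      · simp only [haW, hbW, or_self, if_true, add_zero]
        refine ⟨by omega, ?_⟩
        rw [show v + 2 - 2 * c (W ∩ S) = (v - 2 * c (W ∩ S)) + 2 by omega]
        refine hWS.mul ((X - C a) * (X - C b)) (by compute_degree) hsub hnew
          (fun t ht => ⟨?_, hWmem t ht⟩) (fun t ht htS => ?_) (fun x hx => ?_)
        · simp only [eval_mul, eval_sub, eval_X, eval_C]
          nlinarith [hSa t ht]
        · rcases hmemT t ht htS with rfl | rfl <;> simp [haW, hbW]
        · simp only [eval_mul, eval_sub, eval_X, eval_C]
          exact mul_pos (sub_pos.2 (hx a haT')) (sub_pos.2 (hx b hbT))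
      · simp only [haW, hbW, true_or, if_true, add_zero]
        refine ⟨by omega, ?_⟩
        rw [show v + 2 - 2 * c (W ∩ S) = (v - 2 * c (W ∩ S)) + 2 by omega]
        refine hWS.mul ((X - C a) ^ 2) (by compute_degree) hsub hnew
          (fun t ht => ⟨?_, hWmem t ht⟩) (fun t ht htS => ?_) (fun x hx => ?_)
        · simp only [eval_pow, eval_sub, eval_X, eval_C]
          nlinarith [hSa t ht]
        · rcases hmemT t ht htS with rfl | rfl
          · simp [haW]
          · simp [hbW, sub_eq_zero, hab.ne', sq_nonneg]
        · simp only [eval_pow, eval_sub, eval_X, eval_C]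
          exact pow_pos (sub_pos.2 (hx a haT')) 2
      · simp only [haW, hbW, or_true, if_true, add_zero]
        refine ⟨by omega, ?_⟩
        rw [show v + 2 - 2 * c (W ∩ S) = (v - 2 * c (W ∩ S)) + 2 by omega]
        refine hWS.mul ((X - C b) ^ 2) (by compute_degree) hsub hnew
          (fun t ht => ⟨?_, hWmem t ht⟩) (fun t ht htS => ?_) (fun x hx => ?_)
        · simp only [eval_pow, eval_sub, eval_X, eval_C]
          nlinarith [hSa t ht]
        · rcases hmemT t ht htS with rfl | rfl
          · simp [haW, sub_eq_zero, hab.ne, sq_nonneg]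
          · simp [hbW]
        · simp only [eval_pow, eval_sub, eval_X, eval_C]
          exact pow_pos (sub_pos.2 (hx b hbT)) 2
      · simp only [haW, hbW, or_self, if_false]
        refine ⟨by omega, ?_⟩
        rw [show v + 2 - 2 * (c (W ∩ S) + 1) = (v - 2 * c (W ∩ S)) + 0 by omega]
        refine hWS.mul 1 (by simp) hsub hnew
          (fun t ht => ⟨by simp, hWmem t ht⟩) (fun t ht htS => ?_) (fun x hx => by simp)
        rcases hmemT t ht htS with rfl | rfl <;> simp [haW, hbW]
    · rw [hTS, Finset.sum_powerset_insert hbaS, Finset.sum_powerset_insert haS,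
        Finset.sum_powerset_insert haS, ← Finset.sum_add_distrib, ← Finset.sum_add_distrib,
        ← Finset.sum_add_distrib]
      calc _ = ∑ W ∈ S.powerset, (7 / 2 : ℝ) * (1 / 2) ^ c W := by
            refine Finset.sum_congr rfl fun W hW => ?_
            have hWS := Finset.mem_powerset.1 hW
            have haW : a ∉ W := fun h => haS (hWS h)
            have hbW : b ∉ W := fun h => hbS (hWS h)
            simp only [Finset.insert_inter_of_notMem haS, Finset.insert_inter_of_notMem hbS,
              Finset.inter_eq_left.2 hWS, Finset.mem_insert, haW, hbW, hab.ne, hab.ne', true_or,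
              or_true, or_self, if_true, if_false]
            ring
        _ ≤ 7 / 2 * (2 * (15 / 8) ^ v) := by
            rw [← Finset.mul_sum]
            gcongr
        _ ≤ 2 * (15 / 8) ^ (v + 2) := by
            rw [pow_add]
            nlinarith [show (0 : ℝ) < (15 / 8) ^ v by positivity]

open Classical in
/-- Few subsets of `T` miss at most `n` of the pairs: the exceptional subsets are exponentially
rare among all `2 ^ #T` subsets. -/
lemma card_filter_not_isZeroSetOfNonneg_le (T : Finset ℝ) (n d : ℕ) (hT : T.card = d + 1 + n) :
    ((T.powerset.filter fun W => ¬ IsZeroSetOfNonneg T W d).card : ℝ) ≤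
      2 ^ (n + 1) * (15 / 8) ^ T.card := by
  obtain ⟨c, hc, hsum⟩ := exists_count_missed_pairs T
  have hbad : ∀ W ∈ T.powerset.filter (fun W => ¬ IsZeroSetOfNonneg T W d),
      (1 / 2 : ℝ) ^ n ≤ (1 / 2) ^ c W := by
    intro W hW
    obtain ⟨hWT, hW⟩ := Finset.mem_filter.1 hW
    refine pow_le_pow_of_le_one (by norm_num) (by norm_num) ?_
    by_contra! hlt
    obtain ⟨-, p, hp, h⟩ := hc W (Finset.mem_powerset.1 hWT)
    exact hW ⟨p, hp.trans (by omega), h⟩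
  have h1 := Finset.card_nsmul_le_sum _ _ _ hbad
  have h2 := h1.trans ((Finset.sum_le_sum_of_subset_of_nonneg (Finset.filter_subset _ _)
    fun W _ _ => by positivity).trans hsum)
  rw [nsmul_eq_mul, one_div, inv_pow, ← div_eq_mul_inv, div_le_iff₀ (by positivity)] at h2
  calc _ ≤ _ := h2
    _ = _ := by ring

/-! ### Polynomials as affine functionals along the moment curve -/

open Polynomial in
/-- A polynomial of degree at most `d` is an affine functional restricted to the moment curve. -/
lemma exists_dual_eval_eq {d : ℕ} (p : ℝ[X]) (hp : p.natDegree ≤ d) :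
    ∃ l : StrongDual ℝ (EuclideanSpace ℝ (Fin d)),
      ∀ t, p.eval t = p.coeff 0 + l (momentCurve d t) := by
  refine ⟨∑ i : Fin d, p.coeff (i + 1) • EuclideanSpace.proj i, fun t => ?_⟩
  rw [eval_eq_sum_range' (Nat.lt_succ_of_le hp), Finset.sum_range_succ', add_comm]
  simp [Finset.sum_range, momentCurve]

open Polynomial in
/-- At most `d + 1` points of the moment curve are affinely independent, as there are Lagrange
interpolation polynomials of degree at most `d`. -/
lemma affineIndependent_momentCurve {d : ℕ} (W : Finset ℝ) (hW : W.card ≤ d + 1) :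
    AffineIndependent ℝ (fun t : W => momentCurve d t) := by
  rw [affineIndependent_iff]
  intro s w hw hwM e he
  have hzero : ∀ p : ℝ[X], p.natDegree ≤ d → ∑ i ∈ s, w i * p.eval (i : ℝ) = 0 := by
    intro p hp
    obtain ⟨l, hl⟩ := exists_dual_eval_eq p hp
    have hl0 := congrArg l hwM
    simp only [map_sum, map_smul, smul_eq_mul, map_zero] at hl0
    simp_rw [hl, mul_add, Finset.sum_add_distrib, ← Finset.sum_mul, hw, hl0]
    simp
  have hdeg : (Lagrange.basis W id (e : ℝ)).natDegree ≤ d := by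
    have h := Lagrange.degree_basis (s := W) (v := id) Function.injective_id.injOn e.2
    rw [natDegree_eq_of_degree_eq_some h]
    omega
  have h := hzero _ hdeg
  rw [Finset.sum_eq_single e] at h
  · have h1 := Lagrange.eval_basis_self (s := W) (v := id) Function.injective_id.injOn e.2
    rw [id] at h1
    simpa [h1] using h
  · intro i _ hie
    have h1 := Lagrange.eval_basis_of_ne (s := W) (v := id) (i := (e : ℝ)) (j := (i : ℝ))
      (fun h => hie (Subtype.ext h.symm)) i.2
    rw [id] at h1
    rw [h1, mul_zero]
  · exact fun h => absurd he h

lemma faceDim_convexHull_momentCurve {d : ℕ} (W : Finset ℝ) (hW : W.card ≤ d + 1) :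
    faceDim (convexHull ℝ (momentCurve d '' (W : Set ℝ))) = (W.card : ℤ) - 1 := by
  rcases W.eq_empty_or_nonempty with rfl | hne
  · simp [faceDim]
  · have hpos := hne.card_pos
    rw [faceDim, if_neg (by simpa using hne.ne_empty), affineSpan_convexHull,
      direction_affineSpan]
    have h := (affineIndependent_momentCurve W hW).finrank_vectorSpan (n := W.card - 1)
      (by simp; omega)
    rw [show Set.range (fun t : W => momentCurve d t) = momentCurve d '' (W : Set ℝ) by
      ext; simp] at h
    rw [h]
    omega

/-! ### Faces of a cyclic polytope and their vertex sets -/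

open Classical in
/-- The parameters in `T` of the points of the moment curve that lie in `F`. -/
noncomputable def curveParams {d : ℕ} (T : Finset ℝ) (F : Set (EuclideanSpace ℝ (Fin d))) :
    Finset ℝ :=
  T.filter fun t => momentCurve d t ∈ F

lemma mem_curveParams {d : ℕ} {T : Finset ℝ} {F : Set (EuclideanSpace ℝ (Fin d))} {t : ℝ} :
    t ∈ curveParams T F ↔ t ∈ T ∧ momentCurve d t ∈ F := by
  classical
  rw [curveParams, Finset.mem_filter]

lemma curveParams_subset {d : ℕ} (T : Finset ℝ) (F : Set (EuclideanSpace ℝ (Fin d))) :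
    curveParams T F ⊆ T :=
  fun _ ht => (mem_curveParams.1 ht).1

/-- A face is the convex hull of the generating points it contains, by the Krein–Milman theorem. -/
lemma eq_convexHull_curveParams {d : ℕ} {T : Finset ℝ} {F : Set (EuclideanSpace ℝ (Fin d))}
    (hF : F ∈ polytopeFaces (convexHull ℝ (momentCurve d '' (T : Set ℝ)))) :
    F = convexHull ℝ (momentCurve d '' (curveParams T F : Set ℝ)) := by
  have hE : IsExposed ℝ (convexHull ℝ (momentCurve d '' (T : Set ℝ))) F := hF
  have hcomp : IsCompact F := hE.isCompact ((T.finite_toSet.image _).isCompact_convexHull ℝ)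
  have hconv : Convex ℝ F := hE.convex (convex_convexHull ℝ _)
  refine Set.Subset.antisymm ?_ (convexHull_min ?_ hconv)
  · conv_lhs => rw [← closure_convexHull_extremePoints hcomp hconv]
    refine closure_minimal (convexHull_mono ?_)
      (((curveParams T F).finite_toSet.image _).isClosed_convexHull ℝ)
    rw [hE.isExtreme.extremePoints_eq]
    rintro x ⟨hxF, hx⟩
    obtain ⟨t, ht, rfl⟩ := extremePoints_convexHull_subset hx
    exact ⟨t, Finset.mem_coe.2 (mem_curveParams.2 ⟨ht, hxF⟩), rfl⟩
  · rintro _ ⟨t, ht, rfl⟩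
    exact (mem_curveParams.1 (Finset.mem_coe.1 ht)).2

lemma injOn_curveParams {d : ℕ} (T : Finset ℝ) :
    Set.InjOn (curveParams T) (polytopeFaces (convexHull ℝ (momentCurve d '' (T : Set ℝ)))) := by
  intro F hF G hG h
  rw [eq_convexHull_curveParams hF, eq_convexHull_curveParams hG, h]

/-- The zero set on `T` of a polynomial of degree at most `d` that is nonnegative on `T` spans a
face: the supporting hyperplane is the one defined by the polynomial. -/
lemma IsZeroSetOfNonneg.exists_face {d : ℕ} {T W : Finset ℝ} (h : IsZeroSetOfNonneg T W d)
    (hW : W ⊆ T) :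
    ∃ F ∈ polytopeFaces (convexHull ℝ (momentCurve d '' (T : Set ℝ))), curveParams T F = W := by
  rcases W.eq_empty_or_nonempty with rfl | ⟨w, hw⟩
  · exact ⟨∅, isExposed_empty, by ext; simp [mem_curveParams]⟩
  obtain ⟨p, hp, hpT, -⟩ := h
  obtain ⟨l, hl⟩ := exists_dual_eval_eq p hp
  refine ⟨(-l).toExposed _, ContinuousLinearMap.toExposed.isExposed, ?_⟩
  have hsub := subset_convexHull ℝ (momentCurve d '' (T : Set ℝ))
  have hmem : ∀ t ∈ T, momentCurve d t ∈ convexHull ℝ (momentCurve d '' (T : Set ℝ)) :=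
    fun t ht => hsub ⟨t, ht, rfl⟩
  have hmin : ∀ x ∈ convexHull ℝ (momentCurve d '' (T : Set ℝ)), -p.coeff 0 ≤ l x := by
    refine convexHull_min ?_ (convex_halfSpace_ge l.toLinearMap.isLinear _)
    rintro _ ⟨t, ht, rfl⟩
    have := (hpT t ht).1
    rw [hl] at this
    exact neg_le_iff_add_nonneg'.2 this
  have hw0 : l (momentCurve d w) = -p.coeff 0 := by
    have := (hpT w (hW hw)).2.2 hw
    rw [hl] at this
    linarith
  ext t
  simp only [mem_curveParams, ContinuousLinearMap.toExposed, Set.mem_ofPred_eq,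
    neg_apply, neg_le_neg_iff]
  constructor
  · rintro ⟨ht, -, hmax⟩
    have h1 := hmax _ (hmem w (hW hw))
    have h2 := (hpT t ht).1
    refine (hpT t ht).2.1 (le_antisymm ?_ h2)
    rw [hl]
    linarith
  · intro ht
    refine ⟨hW ht, hmem t (hW ht), fun y hy => ?_⟩
    have h1 := (hpT t (hW ht)).2.2 ht
    rw [hl] at h1
    linarith [hmin y hy]

open Classical in
/-- Up to the exceptional subsets of `T`, the faces with dimension in a given residue class
correspond to the subsets of `T` with size in a residue class: a simplex of dimension `i` has
`i + 1` vertices, and `j` labels dimension `j - 1`. The face `P` itself, not a simplex on `T` for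
`n > 0`, is among the exceptions. -/
lemma abs_modularFVector_sub_le {d n : ℕ} (T : Finset ℝ) (hT : T.card = d + 1 + n) (m : ℕ)
    (j : Fin m) :
    |(modularFVector m (convexHull ℝ (momentCurve d '' (T : Set ℝ))) j : ℝ) -
      ((T.powerset.filter fun W => W.card ≡ j [MOD m]).card : ℝ)| ≤
      2 ^ (n + 1) * (15 / 8) ^ T.card := by
  set P := convexHull ℝ (momentCurve d '' (T : Set ℝ)) with hP
  set A := T.powerset.filter fun W => W.card ≡ j [MOD m]
  set B := T.powerset.filter fun W => ¬ IsZeroSetOfNonneg T W d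
  set 𝓕 : Set (Set (EuclideanSpace ℝ (Fin d))) :=
    {F ∈ polytopeFaces P | faceDim F ≡ (j : ℤ) - 1 [ZMOD (m : ℤ)]}
  set S := T.powerset.filter fun W => W ∈ curveParams T '' 𝓕
  have hcard : modularFVector m P j = S.card := by
    rw [modularFVector, ← ((injOn_curveParams T).mono fun F hF => hF.1).ncard_image,
      ← Set.ncard_coe_finset]
    congr 1
    ext W
    simp only [S, Finset.coe_filter, Set.mem_ofPred_eq, Finset.mem_powerset]
    refine ⟨fun h => ⟨?_, h⟩, fun h => h.2⟩
    obtain ⟨F, -, rfl⟩ := h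
    exact curveParams_subset T F
  have hiff : ∀ W ∈ T.powerset, W ∉ B → (W ∈ S ↔ W ∈ A) := by
    intro W hW hWB
    have hWT := Finset.mem_powerset.1 hW
    have hgood : IsZeroSetOfNonneg T W d := by
      by_contra h
      exact hWB (Finset.mem_filter.2 ⟨hW, h⟩)
    obtain ⟨F, hF, hFW⟩ := hgood.exists_face hWT
    have hdim : faceDim F = (W.card : ℤ) - 1 := by
      rw [eq_convexHull_curveParams hF, hFW]
      exact faceDim_convexHull_momentCurve W ((hgood.card_le hWT).trans d.le_succ)
    have hmod : faceDim F ≡ (j : ℤ) - 1 [ZMOD (m : ℤ)] ↔ W.card ≡ j [MOD m] := by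
      rw [hdim, ← Int.natCast_modEq_iff]
      refine ⟨fun h => ?_, fun h => h.sub_right 1⟩
      simpa using h.add_right 1
    simp only [S, A, Finset.mem_filter, hW, true_and]
    rw [← hmod]
    constructor
    · rintro ⟨G, hG, hGW⟩
      rw [← injOn_curveParams T hG.1 hF (hGW.trans hFW.symm)]
      exact hG.2
    · exact fun h => ⟨F, ⟨hF, h⟩, hFW⟩
  have hSA : S.card ≤ A.card + B.card := by
    refine (Finset.card_le_card fun W hW => ?_).trans (Finset.card_union_le A B)
    by_cases hWB : W ∈ B
    · exact Finset.mem_union_right _ hWB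
    · exact Finset.mem_union_left _ ((hiff W (Finset.mem_filter.1 hW).1 hWB).1 hW)
  have hAS : A.card ≤ S.card + B.card := by
    refine (Finset.card_le_card fun W hW => ?_).trans (Finset.card_union_le S B)
    by_cases hWB : W ∈ B
    · exact Finset.mem_union_right _ hWB
    · exact Finset.mem_union_left _ ((hiff W (Finset.mem_filter.1 hW).1 hWB).2 hW)
  have hB := card_filter_not_isZeroSetOfNonneg_le T n d hT
  have hSA' : (S.card : ℝ) ≤ A.card + B.card := by exact_mod_cast hSA
  have hAS' : (A.card : ℝ) ≤ S.card + B.card := by exact_mod_cast hAS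
  rw [hcard, abs_sub_le_iff]
  constructor <;> linarith

/-- The limit before normalization by the total number of faces: each component is asymptotic to
`2 ^ (k + 1 + n) / m`. -/
lemma tendsto_modularFVector_div_two_pow (n : ℕ) (C : (k : ℕ) → Set (EuclideanSpace ℝ (Fin k)))
    (hC : ∀ k : ℕ, 2 ≤ k → IsCyclicPolytope (k + 1 + n) k (C k)) {m : ℕ} (hm : 0 < m)
    (j : Fin m) :
    Tendsto (fun k : ℕ => (modularFVector m (C k) j : ℝ) / 2 ^ (k + 1 + n)) atTop
      (𝓝 (1 / (m : ℝ))) := by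
  -- For `k < 2` nothing is known about `C k`, so any `T` of the right size serves.
  have hex : ∀ k : ℕ, ∃ T : Finset ℝ, T.card = k + 1 + n ∧
      (2 ≤ k → C k = convexHull ℝ (momentCurve k '' (T : Set ℝ))) := by
    intro k
    by_cases hk : 2 ≤ k
    · obtain ⟨T, hT, h⟩ := hC k hk
      exact ⟨T, hT, fun _ => h⟩
    · obtain ⟨T, hT⟩ := Infinite.exists_subset_card_eq ℝ (k + 1 + n)
      exact ⟨T, hT, fun h => absurd h hk⟩
  choose T hT hCT using hex
  have hv : Tendsto (fun k => k + 1 + n) atTop atTop :=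
    tendsto_atTop_mono (fun k => by simp only [id]; omega) tendsto_id
  have hA := tendsto_card_powerset_filter_modEq T (by simpa only [hT] using hv) hm j
  simp only [hT] at hA
  have herr : Tendsto (fun k : ℕ => (2 : ℝ) ^ (n + 1) * (15 / 16) ^ (k + 1 + n)) atTop (𝓝 0) := by
    simpa using ((tendsto_pow_atTop_nhds_zero_of_lt_one (r := (15 / 16 : ℝ)) (by norm_num)
      (by norm_num)).comp hv).const_mul ((2 : ℝ) ^ (n + 1))
  have hdiff : Tendsto (fun k : ℕ => (modularFVector m (C k) j : ℝ) / 2 ^ (k + 1 + n) -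
      (((T k).powerset.filter fun W => W.card ≡ j [MOD m]).card : ℝ) / 2 ^ (k + 1 + n)) atTop
      (𝓝 0) := by
    refine squeeze_zero_norm' ?_ herr
    filter_upwards [eventually_ge_atTop 2] with k hk
    rw [← sub_div, norm_div, Real.norm_eq_abs, Real.norm_of_nonneg (by positivity), hCT k hk]
    rw [div_le_iff₀ (by positivity), mul_assoc, ← mul_pow]
    have h := abs_modularFVector_sub_le (T k) (hT k) m j
    rw [hT k] at h
    norm_num at h ⊢
    exact h
  simpa using hdiff.add hA

theorem theorem3 (n : ℕ) (C : (k : ℕ) → Set (EuclideanSpace ℝ (Fin k)))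
    (hC : ∀ k : ℕ, 2 ≤ k → IsCyclicPolytope (k + 1 + n) k (C k))
    (m : ℕ) (hm : 0 < m) :
    Tendsto
      (fun k : ℕ => fun j : Fin m =>
        (modularFVector m (C k) j : ℝ) / (modularFVector 1 (C k) 0 : ℝ))
      atTop (𝓝 (fun _ : Fin m => 1 / (m : ℝ))) := by
  rw [tendsto_pi_nhds]
  intro j
  have h := (tendsto_modularFVector_div_two_pow n C hC hm j).div
    (tendsto_modularFVector_div_two_pow n C hC one_pos 0) (by norm_num)
  simp only [Nat.cast_one, div_one] at h
  exact h.congr fun k => div_div_div_cancel_right₀ (by positivity) _ _
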